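/- **Bicategory-enriched notions.** Let $\mathcal W$ be a bicategory, with composition and identities of $1$-cells written $\otimes$ and $I_x$. A $\mathcal W$-category $\mathcal C$ has objects $X$, each with an extent $\epsilon X\in\mathcal W$, hom-objects $\mathcal C(X,Y)\in\mathcal W(\epsilon X,\epsilon Y)$, composition maps $\mu\colon\mathcal C(Y,Z)\otimes\mathcal C(X,Y)\to\mathcal C(X,Z)$ and identities maps $I_{\epsilon X}\to\mathcal C(X,X)$, subject to the associativity and unit axioms. A $\mathcal W$-functor $F\colon\mathcal C\to\mathcal D$ is an extent-preserving map on objects together with maps $\mathcal C(X,Y)\to\mathcal D(FX,FY)$ compatible with composition and identities. Write $\mathcal C_x$ for the collection of objects of extent $x$. A tensor of $X\in\mathcal C_x$ by a $1$-cell $W\in\mathcal W(x,y)$ is an object $W\cdot X\in\mathcal C_y$ with a map $t\colon W\to\mathcal C(X,W\cdot X)$ such that, for all $z\in\mathcal W$, $U\in\mathcal W(y,z)$ and $Z\in\mathcal C_z$, the assignment $f\mapsto\mu\circ(f\otimes t)$ is a bijection from maps $U\to\mathcal C(W\cdot X,Z)$ to maps $U\otimes W\to\mathcal C(X,Z)$.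 A $\mathcal W$-functor $F\colon\mathcal C\to\mathcal D$ preserves this tensor if $W\xrightarrow{t}\mathcal C(X,W\cdot X)\to\mathcal D(FX,F(W\cdot X))$ exhibits $F(W\cdot X)$ as a tensor of $FX$ by $W$. Tensors by $W$ are absolute if every tensor by $W$ in every $\mathcal W$-category is preserved by every $\mathcal W$-functor. A $\mathcal W$-category $\mathcal C$ is absolute-tensored if, for every $1$-cell $W\in\mathcal W(x,y)$ such that tensors by $W$ are absolute, and for every $X\in\mathcal C_x$, a tensor of $X$ by $W$ exists in $\mathcal C$. **Lex profunctors.** The bicategory $\mathbf{LexProf}$ has as objects small categories with finite limits; as $1$-cells $\mathbb A\to\mathbb B$ functors $M\colon\mathbb A^{\mathrm{op}}\times\mathbb B\to\mathbf{Set}$ preserving finite limits in the second variable; and as $2$-cells natural transformations. Its identities are $I_{\mathbb A}(a',a)=\mathbb A(a',a)$, and its composition is $(N\otimes M)(a,c)=\int^{b\in\mathbb B}N(b,c)\times M(a,b)$. For a $\mathbf{LexProf}$-category $\mathcal C$, let $\int\mathcal C$ be the category whose objects are pairs $(X,i)$ with $X\in\mathcal C_{\mathbb A}$ and $i\in\mathbb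 A$, whose morphisms $(X,i)\to(Y,j)$ are the elements of $\mathcal C(X,Y)(i,j)$, and whose composition and identities are induced by those of $\mathcal C$. For $X\in\mathcal C_{\mathbb A}$, let $\iota_X\colon\mathbb A\to\int\mathcal C$ be the functor $i\mapsto(X,i)$, acting on morphisms by the identities map $\mathbb A(i,j)\to\mathcal C(X,X)(i,j)$ of $\mathcal C$. **Proposition.** A $\mathbf{LexProf}$-category $\mathcal C$ is absolute-tensored if and only if, for all small categories $\mathbb A,\mathbb B$ with finite limits, all objects $X\in\mathcal C_{\mathbb B}$ and all finite-limit-preserving functors $F\colon\mathbb A\to\mathbb B$, there exist an object $Y\in\mathcal C_{\mathbb A}$ and a natural isomorphism $\iota_X\circ F\cong\iota_Y$ of functors $\mathbb A\to\int\mathcal C$. -/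

import Mathlib

open CategoryTheory CategoryTheory.Limits Opposite Bicategory

universe w' w v₂ v₁ u

/-! ### Categories enriched in a bicategory -/

/-- A category enriched in a bicategory `W`. The collection of objects together with its extent
function is given by its fibres: `Obj x` is the collection of objects of extent `x`.
With `f ≫ g` for the composite of `1`-cells in diagrammatic order, the hom-object of `X` and `Y`
is a `1`-cell from the extent of `X` to the extent of `Y`. -/
structure BicatEnrichedCat (W : Type u) [Bicategory.{v₂, v₁} W] where
  Obj : W → Type w
  hom : ∀ {x y : W} (_ : Obj x) (_ : Obj y), x ⟶ y
  comp : ∀ {x y z : W} (X : Obj x) (Y : Obj y) (Z : Obj z), hom X Y ≫ hom Y Z ⟶ hom X Z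
  id : ∀ {x : W} (X : Obj x), 𝟙 x ⟶ hom X X
  id_comp : ∀ {x y : W} (X : Obj x) (Y : Obj y),
    id X ▷ hom X Y ≫ comp X X Y = (λ_ (hom X Y)).hom
  comp_id : ∀ {x y : W} (X : Obj x) (Y : Obj y),
    hom X Y ◁ id Y ≫ comp X Y Y = (ρ_ (hom X Y)).hom
  assoc : ∀ {x y z t : W} (X : Obj x) (Y : Obj y) (Z : Obj z) (T : Obj t),
    comp X Y Z ▷ hom Z T ≫ comp X Z T =
      (α_ (hom X Y) (hom Y Z) (hom Z T)).hom ≫ hom X Y ◁ comp Y Z T ≫ comp X Y T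

/-- A functor between categories enriched in a bicategory: an extent-preserving assignment on
objects and maps of hom-objects compatible with composition and identities. -/
structure BicatEnrichedFunctor {W : Type u} [Bicategory.{v₂, v₁} W]
    (C : BicatEnrichedCat.{w} W) (D : BicatEnrichedCat.{w'} W) where
  obj : ∀ {x : W}, C.Obj x → D.Obj x
  map : ∀ {x y : W} (X : C.Obj x) (Y : C.Obj y), C.hom X Y ⟶ D.hom (obj X) (obj Y)
  map_id : ∀ {x : W} (X : C.Obj x), C.id X ≫ map X X = D.id (obj X)
  map_comp : ∀ {x y z : W} (X : C.Obj x) (Y : C.Obj y) (Z : C.Obj z),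
    C.comp X Y Z ≫ map X Z =
      map X Y ▷ C.hom Y Z ≫ D.hom (obj X) (obj Y) ◁ map Y Z ≫ D.comp (obj X) (obj Y) (obj Z)

namespace BicatEnrichedCat

variable {W : Type u} [Bicategory.{v₂, v₁} W]

/-- `t : V ⟶ C(X, Y)` exhibits `Y` as the tensor `V · X` of `X` by the `1`-cell `V`: for all `U`
and `Z`, sending `f : U ⟶ C(Y, Z)` to the composite of `f ⊗ t` with the composition map of `C`
is a bijection from maps `U ⟶ C(Y, Z)` to maps `U ⊗ V ⟶ C(X, Z)`. -/
def IsTensor (C : BicatEnrichedCat.{w} W) {x y : W} (X : C.Obj x) (V : x ⟶ y) (Y : C.Obj y)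
    (t : V ⟶ C.hom X Y) : Prop :=
  ∀ {z : W} (U : y ⟶ z) (Z : C.Obj z),
    Function.Bijective
      (fun f : U ⟶ C.hom Y Z => (V ◁ f ≫ t ▷ C.hom Y Z ≫ C.comp X Y Z : V ≫ U ⟶ C.hom X Z))

end BicatEnrichedCat

/-- Tensors by the `1`-cell `V` are absolute: every enriched functor preserves every tensor
by `V`. -/
def TensorsAreAbsolute {W : Type u} [Bicategory.{v₂, v₁} W] {x y : W} (V : x ⟶ y) : Prop :=
  ∀ (C D : BicatEnrichedCat.{w} W) (F : BicatEnrichedFunctor C D) (X : C.Obj x) (Y : C.Obj y)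
    (t : V ⟶ C.hom X Y), C.IsTensor X V Y t → D.IsTensor (F.obj X) V (F.obj Y) (t ≫ F.map X Y)

/-- A category enriched in a bicategory is absolute-tensored if it admits all absolute tensors,
i.e. has a tensor of every object by every `1`-cell (starting at the extent of that object)
tensors by which are absolute. -/
def BicatEnrichedCat.IsAbsoluteTensored {W : Type u} [Bicategory.{v₂, v₁} W]
    (C : BicatEnrichedCat.{w} W) : Prop :=
  ∀ {x y : W} (V : x ⟶ y), TensorsAreAbsolute.{w'} V →
    ∀ X : C.Obj x, ∃ (Y : C.Obj y) (t : V ⟶ C.hom X Y), C.IsTensor X V Y t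

/-! ### The bicategory of lex profunctors -/

/-- Objects of the bicategory of lex profunctors: small categories with finite limits. -/
structure LexProf : Type (u + 1) where
  carrier : Type u
  [category : SmallCategory carrier]
  [hasFiniteLimits : HasFiniteLimits carrier]

attribute [instance] LexProf.category LexProf.hasFiniteLimits

instance : CoeSort LexProf.{u} (Type u) := ⟨LexProf.carrier⟩

/-- A lex profunctor from `A` to `B`: a functor `Aᵒᵖ × B ⥤ Type` preserving finite limits in its
second variable, written in curried form. -/
structure LexProfunctor (A B : LexProf.{u}) : Type (u + 1) where
  functor : (A : Type u)ᵒᵖ ⥤ (B : Type u) ⥤ Type u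
  lex : ∀ a : (A : Type u)ᵒᵖ, PreservesFiniteLimits (functor.obj a)

namespace LexProfunctor

variable {A B C D : LexProf.{u}}

/-- Maps of lex profunctors are natural transformations. -/
instance : Category.{u} (LexProfunctor A B) where
  Hom M N := M.functor ⟶ N.functor
  id M := 𝟙 M.functor
  comp f g := NatTrans.vcomp f g

/-- The set `M(a, b)`. -/
def el (M : LexProfunctor A B) (a : A) (b : B) : Type u := (M.functor.obj (op a)).obj b

/-- The contravariant action of `M` on elements. -/
def l (M : LexProfunctor A B) {a' a : A} (f : a' ⟶ a) {b : B} (x : M.el a b) : M.el a' b :=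
  (M.functor.map f.op).app b x

/-- The covariant action of `M` on elements. -/
def r (M : LexProfunctor A B) {a : A} {b b' : B} (g : b ⟶ b') (x : M.el a b) : M.el a b' :=
  (M.functor.obj (op a)).map g x

/-- The component of a map of lex profunctors at `(a, b)`. -/
def ev {M N : LexProfunctor A B} (α : M ⟶ N) {a : A} {b : B} (x : M.el a b) : N.el a b :=
  (NatTrans.app (F := M.functor) (G := N.functor) α (op a)).app b x

section basic

variable (M : LexProfunctor A B) {N P : LexProfunctor A B}

@[simp] lemma l_id {a : A} {b : B} (x : M.el a b) : M.l (𝟙 a) x = x :=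
  ConcreteCategory.congr_hom (NatTrans.congr_app (M.functor.map_id (op a)) b) x

@[simp] lemma r_id {a : A} {b : B} (x : M.el a b) : M.r (𝟙 b) x = x :=
  ConcreteCategory.congr_hom ((M.functor.obj (op a)).map_id b) x

lemma l_comp {a a' a'' : A} (f : a ⟶ a') (g : a' ⟶ a'') {b : B} (x : M.el a'' b) :
    M.l (f ≫ g) x = M.l f (M.l g x) :=
  ConcreteCategory.congr_hom (NatTrans.congr_app (M.functor.map_comp g.op f.op) b) x

lemma r_comp {a : A} {b b' b'' : B} (f : b ⟶ b') (g : b' ⟶ b'') (x : M.el a b) :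
    M.r (f ≫ g) x = M.r g (M.r f x) :=
  ConcreteCategory.congr_hom ((M.functor.obj (op a)).map_comp f g) x

lemma l_r {a a' : A} (f : a ⟶ a') {b b' : B} (g : b ⟶ b') (x : M.el a' b) :
    M.l f (M.r g x) = M.r g (M.l f x) :=
  ConcreteCategory.congr_hom ((M.functor.map f.op).naturality g) x

variable {M}

@[simp] lemma ev_l (α : M ⟶ N) {a a' : A} (f : a ⟶ a') {b : B} (x : M.el a' b) :
    ev α (M.l f x) = N.l f (ev α x) :=
  ConcreteCategory.congr_hom (NatTrans.congr_app
    (NatTrans.naturality (F := M.functor) (G := N.functor) α f.op) b) x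

@[simp] lemma ev_r (α : M ⟶ N) {a : A} {b b' : B} (g : b ⟶ b') (x : M.el a b) :
    ev α (M.r g x) = N.r g (ev α x) :=
  ConcreteCategory.congr_hom
    ((NatTrans.app (F := M.functor) (G := N.functor) α (op a)).naturality g) x

@[simp] lemma ev_id {a : A} {b : B} (x : M.el a b) : ev (𝟙 M) x = x := rfl

@[simp] lemma ev_comp (α : M ⟶ N) (β : N ⟶ P) {a : A} {b : B} (x : M.el a b) :
    ev (α ≫ β) x = ev β (ev α x) := rfl

lemma hom_ext {α β : M ⟶ N} (h : ∀ (a : A) (b : B) (x : M.el a b), ev α x = ev β x) : α = β := by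
  refine NatTrans.ext (funext fun a => NatTrans.ext (funext fun b => ?_))
  ext x
  exact h a.unop b x

/-- A map of lex profunctors from its components. -/
def homMk (M N : LexProfunctor A B) (f : ∀ (a : A) (b : B), M.el a b → N.el a b)
    (hl : ∀ {a a' : A} (g : a ⟶ a') {b : B} (x : M.el a' b), f a b (M.l g x) = N.l g (f a' b x))
    (hr : ∀ {a : A} {b b' : B} (g : b ⟶ b') (x : M.el a b), f a b' (M.r g x) = N.r g (f a b x)) :
    M ⟶ N :=
  show M.functor ⟶ N.functor from
  { app := fun a =>
      { app := fun b => ↾(f a.unop b)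
        naturality := fun b b' g => by ext x; exact hr g x }
    naturality := fun a a' g => by ext b x; exact hl g.unop x }

@[simp] lemma ev_homMk (f : ∀ (a : A) (b : B), M.el a b → N.el a b) (hl) (hr) {a : A} {b : B}
    (x : M.el a b) : ev (homMk M N f hl hr) x = f a b x := rfl

end basic

/-- The identity lex profunctor `(a', a) ↦ A(a', a)`. -/
def idProf (A : LexProf.{u}) : LexProfunctor A A where
  functor := coyoneda
  lex _ := inferInstance

/-- A morphism of `A` as an element of the identity lex profunctor. -/
def idEl {a a' : A} (f : a ⟶ a') : (idProf A).el a a' := f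

/-- An element of the identity lex profunctor as a morphism of `A`. -/
def idHom {a a' : A} (f : (idProf A).el a a') : a ⟶ a' := f

@[simp] lemma idEl_idHom {a a' : A} (f : (idProf A).el a a') : idEl (idHom f) = f := rfl

@[simp] lemma idHom_idEl {a a' : A} (f : a ⟶ a') : idHom (idEl f) = f := rfl

@[simp] lemma idHom_l {a a' a'' : A} (f : a ⟶ a') (g : (idProf A).el a' a'') :
    idHom ((idProf A).l f g) = f ≫ idHom g := rfl

@[simp] lemma idHom_r {a a' a'' : A} (f : (idProf A).el a a') (g : a' ⟶ a'') :
    idHom ((idProf A).r g f) = idHom f ≫ g := rfl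

lemma idEl_l {a a' a'' : A} (f : a ⟶ a') (g : a' ⟶ a'') :
    (idProf A).l f (idEl g) = idEl (f ≫ g) := rfl

lemma idEl_r {a a' a'' : A} (f : a ⟶ a') (g : a' ⟶ a'') :
    (idProf A).r g (idEl f) = idEl (f ≫ g) := rfl

@[simp] lemma l_idEl_id {a a' : A} (f : (idProf A).el a a') :
    (idProf A).l (idHom f) (idEl (𝟙 a')) = f := Category.comp_id (idHom f)

@[simp] lemma r_idEl_id {a a' : A} (f : (idProf A).el a a') :
    (idProf A).r (idHom f) (idEl (𝟙 a)) = f := Category.id_comp (idHom f)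

section composition

variable (M : LexProfunctor A B) (N : LexProfunctor B C)

/-- The functor `(b', b) ↦ N(b', c) × M(a, b)` whose coend is `(N ⊗ M)(a, c)`. -/
@[simps]
def coendDiagram (a : A) (c : C) : (B : Type u)ᵒᵖ ⥤ (B : Type u) ⥤ Type u where
  obj b' :=
    { obj := fun b => N.el b'.unop c × M.el a b
      map := fun g => ↾fun p => (p.1, M.r g p.2)
      map_id := fun b => by ext p <;> simp
      map_comp := fun f g => by ext p <;> simp [r_comp] }
  map f := { app := fun b => ↾fun p => (N.l f.unop p.1, p.2) }
  map_id b := by ext c p <;> simp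
  map_comp f g := by ext c p <;> simp [l_comp]

/-- The coend of `N(b, c) × M(a, b)` over `b`. -/
def compEl (a : A) (c : C) : Type u := Limits.Types.coend.{u} (coendDiagram M N a c)

variable {M N}

/-- The class of a pair of elements in the coend. -/
def mkPair {a : A} {b : B} {c : C} (n : N.el b c) (m : M.el a b) : compEl M N a c :=
  Quot.mk _ ⟨b, (n, m)⟩

lemma mkPair_l {a : A} {b b' : B} {c : C} (f : b ⟶ b') (n : N.el b' c) (m : M.el a b) :
    mkPair (N.l f n) m = mkPair n (M.r f m) :=
  Quot.sound (Limits.Types.coendRel.mk (F := coendDiagram M N a c) f (n, m))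

lemma mkPair_surj {a : A} {c : C} (x : compEl M N a c) :
    ∃ (b : B) (n : N.el b c) (m : M.el a b), x = mkPair n m := by
  obtain ⟨⟨b, n, m⟩⟩ := x
  exact ⟨b, n, m, rfl⟩

/-- Functions out of the coend are dinatural families. -/
def descEl {a : A} {c : C} {T : Type v₁} (f : ∀ b : B, N.el b c → M.el a b → T)
    (hf : ∀ {b b' : B} (g : b ⟶ b') (n : N.el b' c) (m : M.el a b),
      f b (N.l g n) m = f b' n (M.r g m)) : compEl M N a c → T :=
  Quot.lift (fun p => f p.1 p.2.1 p.2.2) (by rintro _ _ ⟨g, n, m⟩; exact hf g n m)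

variable (M N)

/-- The action of `N ⊗ M` on morphisms of `A` and `C`. -/
def compMap {a a' : A} (f : a' ⟶ a) {c c' : C} (g : c ⟶ c') : compEl M N a c → compEl M N a' c' :=
  descEl (fun _ n m => mkPair (N.r g n) (M.l f m)) (fun h n m => by rw [← l_r, mkPair_l, l_r])

@[simp] lemma compMap_mkPair {a a' : A} (f : a' ⟶ a) {c c' : C} (g : c ⟶ c') {b : B}
    (n : N.el b c) (m : M.el a b) :
    compMap M N f g (mkPair n m) = mkPair (N.r g n) (M.l f m) := rfl

/-- The functor underlying the composite lex profunctor `N ⊗ M`. -/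
def compFunctor : (A : Type u)ᵒᵖ ⥤ (C : Type u) ⥤ Type u where
  obj a :=
    { obj := fun c => compEl M N a.unop c
      map := fun g => ↾(compMap M N (𝟙 _) g)
      map_id := fun c => by
        ext x; obtain ⟨b, n, m, rfl⟩ := mkPair_surj x; simp
      map_comp := fun f g => by
        ext x; obtain ⟨b, n, m, rfl⟩ := mkPair_surj x; simp [r_comp] }
  map f :=
    { app := fun c => ↾(compMap M N f.unop (𝟙 _))
      naturality := fun c c' g => by
        ext x; obtain ⟨b, n, m, rfl⟩ := mkPair_surj x; simp }
  map_id a := by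
    ext c x; obtain ⟨b, n, m, rfl⟩ := mkPair_surj x; simp
  map_comp f g := by
    ext c x; obtain ⟨b, n, m, rfl⟩ := mkPair_surj x; simp [l_comp]

/-- The functor `(N ⊗ M)(a, -)` is the colimit of the functors `N(b, -)` over the opposite of the
(cofiltered) category of elements `(b, m)` of `M(a, -)`. -/
def compCocone (a : (A : Type u)ᵒᵖ) :
    Cocone ((CategoryOfElements.π (M.functor.obj a)).op ⋙ N.functor) where
  pt := (compFunctor M N).obj a
  ι :=
    { app := fun p =>
        { app := fun c => ↾fun n => mkPair (N := N) (a := a.unop) (b := p.unop.1) n p.unop.2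
          naturality := fun c c' g => by
            ext n
            exact (congrArg (mkPair _) (M.l_id _)).symm }
      naturality := fun p q f => by
        ext c n
        exact (mkPair_l f.unop.1 n q.unop.2).trans (congrArg (mkPair _) f.unop.2) }

/-- The cocone above is a colimit. -/
def compCoconeIsColimit (a : (A : Type u)ᵒᵖ) : IsColimit (compCocone M N a) where
  desc s :=
    { app := fun c => ↾(descEl (M := M) (N := N) (a := a.unop) (fun b n m =>
          (NatTrans.app (s.ι.app (op (⟨b, m⟩ : (M.functor.obj a).Elements))) c) n)
        (fun {b b'} g n m => ConcreteCategory.congr_hom (NatTrans.congr_app (s.w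
          (Quiver.Hom.op (CategoryOfElements.homMk
            (⟨b, m⟩ : (M.functor.obj a).Elements) ⟨b', M.r g m⟩ g rfl))) c) n))
      naturality := fun c c' g => by
        ext x
        obtain ⟨b, n, m, rfl⟩ := mkPair_surj (M := M) (N := N) (a := a.unop) x
        refine Eq.trans ?_ (ConcreteCategory.congr_hom (NatTrans.naturality
          (s.ι.app (op (⟨b, m⟩ : (M.functor.obj a).Elements))) g) n)
        exact congrArg (fun m' : M.el a.unop b => show s.pt.obj c' from
          (NatTrans.app (s.ι.app (op (⟨b, m'⟩ : (M.functor.obj a).Elements))) c') (N.r g n))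
          (M.l_id m) }
  fac s p := by ext c n; rfl
  uniq s f hf := by
    ext c x
    obtain ⟨b, n, m, rfl⟩ := mkPair_surj (M := M) (N := N) (a := a.unop) x
    exact ConcreteCategory.congr_hom
      (NatTrans.congr_app (hf (op (⟨b, m⟩ : (M.functor.obj a).Elements))) c) n

lemma compFunctor_lex (a : (A : Type u)ᵒᵖ) :
    PreservesFiniteLimits ((compFunctor M N).obj a) := by
  have := M.lex a
  have : HasFiniteLimits (M.functor.obj a).Elements := ⟨fun J _ _ => inferInstance⟩
  have : IsCofiltered (M.functor.obj a).Elements := IsCofiltered.of_hasFiniteLimits _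
  exact ObjectProperty.prop_of_isColimit
    (ObjectProperty.preservesFiniteLimits (J := (C : Type u)) (C := Type u))
    (compCoconeIsColimit M N a) (fun p => N.lex _)

/-- The composite lex profunctor `N ⊗ M`. -/
def compProf : LexProfunctor A C where
  functor := compFunctor M N
  lex := compFunctor_lex M N

end composition

section structure_maps

variable {M M' : LexProfunctor A B} {N N' : LexProfunctor B C}

/-- The element of `(N ⊗ M)(a, c)` represented by `(n, m)` in `N(b, c) × M(a, b)`. -/
def pair {a : A} {b : B} {c : C} (n : N.el b c) (m : M.el a b) : (compProf M N).el a c :=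
  mkPair n m

lemma pair_l {a : A} {b b' : B} {c : C} (f : b ⟶ b') (n : N.el b' c) (m : M.el a b) :
    pair (N.l f n) m = pair n (M.r f m) := mkPair_l f n m

lemma pair_surj {a : A} {c : C} (x : (compProf M N).el a c) :
    ∃ (b : B) (n : N.el b c) (m : M.el a b), x = pair n m := mkPair_surj x

/-- Functions out of `(N ⊗ M)(a, c)` are dinatural families. -/
def desc {a : A} {c : C} {T : Type v₁} (f : ∀ b : B, N.el b c → M.el a b → T)
    (hf : ∀ {b b' : B} (g : b ⟶ b') (n : N.el b' c) (m : M.el a b),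
      f b (N.l g n) m = f b' n (M.r g m)) : (compProf M N).el a c → T :=
  descEl f hf

@[simp] lemma desc_pair {a : A} {c : C} {T : Type v₁} (f : ∀ b : B, N.el b c → M.el a b → T) (hf)
    {b : B} (n : N.el b c) (m : M.el a b) : desc f hf (pair n m) = f b n m := rfl

@[simp] lemma compProf_l {a a' : A} (f : a' ⟶ a) {b : B} {c : C} (n : N.el b c) (m : M.el a b) :
    (compProf M N).l f (pair n m) = pair n (M.l f m) := congrArg (pair · _) (N.r_id n)

@[simp] lemma compProf_r {a : A} {b : B} {c c' : C} (g : c ⟶ c') (n : N.el b c) (m : M.el a b) :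
    (compProf M N).r g (pair n m) = pair (N.r g n) m := congrArg (pair _ ·) (M.l_id m)

lemma comp_hom_ext {P : LexProfunctor A C} {α β : compProf M N ⟶ P}
    (h : ∀ (a : A) (b : B) (c : C) (n : N.el b c) (m : M.el a b),
      ev α (pair n m) = ev β (pair n m)) : α = β :=
  hom_ext fun a c x => by obtain ⟨b, n, m, rfl⟩ := pair_surj x; exact h a b c n m

/-- A map out of a composite of lex profunctors from a natural and dinatural family. -/
def descHom (P : LexProfunctor A C)
    (f : ∀ (a : A) (b : B) (c : C), N.el b c → M.el a b → P.el a c)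
    (hd : ∀ {a : A} {b b' : B} {c : C} (g : b ⟶ b') (n : N.el b' c) (m : M.el a b),
      f a b c (N.l g n) m = f a b' c n (M.r g m))
    (hl : ∀ {a a' : A} {b : B} {c : C} (g : a ⟶ a') (n : N.el b c) (m : M.el a' b),
      f a b c n (M.l g m) = P.l g (f a' b c n m))
    (hr : ∀ {a : A} {b : B} {c c' : C} (g : c ⟶ c') (n : N.el b c) (m : M.el a b),
      f a b c' (N.r g n) m = P.r g (f a b c n m)) : compProf M N ⟶ P :=
  homMk _ _ (fun a c => desc (fun b n m => f a b c n m) hd)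
    (fun g c x => by
      obtain ⟨b, n, m, rfl⟩ := pair_surj x
      rw [compProf_l]
      exact hl g n m)
    (fun g x => by
      obtain ⟨b, n, m, rfl⟩ := pair_surj x
      rw [compProf_r]
      exact hr g n m)

@[simp] lemma ev_descHom {P : LexProfunctor A C}
    (f : ∀ (a : A) (b : B) (c : C), N.el b c → M.el a b → P.el a c) (hd) (hl) (hr)
    {a : A} {b : B} {c : C} (n : N.el b c) (m : M.el a b) :
    ev (descHom P f hd hl hr) (pair n m) = f a b c n m := rfl

/-- The map `η ⊗ M`, sending the class of `(n, m)` to that of `(η n, m)`. -/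
def whiskerL (M : LexProfunctor A B) (η : N ⟶ N') : compProf M N ⟶ compProf M N' :=
  descHom _ (fun _ _ _ n m => pair (ev η n) m)
    (fun g n m => by rw [ev_l, pair_l]) (fun g n m => by simp) (fun g n m => by simp)

/-- The map `N ⊗ η`, sending the class of `(n, m)` to that of `(n, η m)`. -/
def whiskerR (η : M ⟶ M') (N : LexProfunctor B C) : compProf M N ⟶ compProf M' N :=
  descHom _ (fun _ _ _ n m => pair n (ev η m))
    (fun g n m => by rw [ev_r, pair_l]) (fun g n m => by simp) (fun g n m => by simp)

@[simp] lemma ev_whiskerL (M : LexProfunctor A B) (η : N ⟶ N') {a : A} {b : B} {c : C}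
    (n : N.el b c) (m : M.el a b) : ev (whiskerL M η) (pair n m) = pair (ev η n) m := rfl

@[simp] lemma ev_whiskerR (η : M ⟶ M') (N : LexProfunctor B C) {a : A} {b : B} {c : C}
    (n : N.el b c) (m : M.el a b) : ev (whiskerR η N) (pair n m) = pair n (ev η m) := rfl

/-- The associator, sending the class of `(p, (n, m))` to that of `((p, n), m)`. -/
def assocIso (M : LexProfunctor A B) (N : LexProfunctor B C) (P : LexProfunctor C D) :
    compProf (compProf M N) P ≅ compProf M (compProf N P) where
  hom := descHom _
    (fun a c d p => desc (fun b n m => pair (N := compProf N P) (pair p n) m)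
      (fun g n m => by rw [← pair_l, compProf_l]))
    (fun g p x => by
      obtain ⟨b, n, m, rfl⟩ := pair_surj x
      simp [pair_l])
    (fun g p x => by
      obtain ⟨b, n, m, rfl⟩ := pair_surj x
      simp)
    (fun g p x => by
      obtain ⟨b, n, m, rfl⟩ := pair_surj x
      simp)
  inv := descHom _
    (fun a b d x m => desc (fun c p n => pair (M := compProf M N) p (pair n m))
      (fun g p n => by rw [pair_l, compProf_r]) x)
    (fun g x m => by
      obtain ⟨c, p, n, rfl⟩ := pair_surj x
      simp [pair_l])
    (fun g x m => by
      obtain ⟨c, p, n, rfl⟩ := pair_surj x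
      simp)
    (fun g x m => by
      obtain ⟨c, p, n, rfl⟩ := pair_surj x
      simp)
  hom_inv_id := comp_hom_ext fun a c d p x => by
    obtain ⟨b, n, m, rfl⟩ := pair_surj x
    rfl
  inv_hom_id := comp_hom_ext fun a b d x m => by
    obtain ⟨c, p, n, rfl⟩ := pair_surj x
    rfl

/-- The unitor `M ⊗ I ≅ M`, sending the class of `(m, f)` to `M(f, 1)(m)`. -/
def leftUnitorIso (M : LexProfunctor A B) : compProf (idProf A) M ≅ M where
  hom := descHom _ (fun _ _ _ m f => M.l (idHom f) m)
    (fun g n m => by simp [l_comp]) (fun g n m => by simp [l_comp]) (fun g n m => by simp [l_r])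
  inv := homMk _ _ (fun a b m => pair m (idEl (𝟙 a)))
    (fun g b m => by simp [pair_l, idEl_l, idEl_r]) (fun g m => by simp)
  hom_inv_id := comp_hom_ext fun a a' b m f => by simp
  inv_hom_id := hom_ext fun a b m => by simp

/-- The unitor `I ⊗ M ≅ M`, sending the class of `(f, m)` to `M(1, f)(m)`. -/
def rightUnitorIso (M : LexProfunctor A B) : compProf M (idProf B) ≅ M where
  hom := descHom _ (fun _ _ _ f m => M.r (idHom f) m)
    (fun g n m => by simp [r_comp]) (fun g n m => by simp [l_r]) (fun g n m => by simp [r_comp])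
  inv := homMk _ _ (fun a b m => pair (idEl (𝟙 b)) m)
    (fun g b m => by simp) (fun g m => by simp [← pair_l, idEl_l, idEl_r])
  hom_inv_id := comp_hom_ext fun a b b' f m => by simp
  inv_hom_id := hom_ext fun a b m => by simp

end structure_maps

end LexProfunctor

open LexProfunctor in
/-- The bicategory of lex profunctors. The composite `M ≫ N`, in diagrammatic order, is the
lex profunctor `(N ⊗ M)(a, c) = ∫^b N(b, c) × M(a, b)`. -/
instance : Bicategory.{u, u + 1} LexProf.{u} where
  Hom A B := LexProfunctor A B
  id A := idProf A
  comp M N := compProf M N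
  whiskerLeft M _ _ η := whiskerL M η
  whiskerRight η N := whiskerR η N
  associator M N P := assocIso M N P
  leftUnitor M := leftUnitorIso M
  rightUnitor M := rightUnitorIso M
  whiskerLeft_id _ _ := by
    refine comp_hom_ext ?_
    intros
    rfl
  whiskerLeft_comp _ _ _ _ _ _ := by
    refine comp_hom_ext ?_
    intros
    rfl
  id_whiskerLeft η := by
    refine comp_hom_ext ?_
    intro _ _ _ n f
    change pair (ev η n) f = pair (ev η (l _ (idHom f) n)) (idEl (𝟙 _))
    rw [ev_l, pair_l, r_idEl_id]
  comp_whiskerLeft _ _ _ _ _ := by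
    refine comp_hom_ext ?_
    intro _ _ _ p x
    obtain ⟨b, n, m, rfl⟩ := pair_surj x
    rfl
  id_whiskerRight _ _ := by
    refine comp_hom_ext ?_
    intros
    rfl
  comp_whiskerRight _ _ _ := by
    refine comp_hom_ext ?_
    intros
    rfl
  whiskerRight_id η := by
    refine comp_hom_ext ?_
    intro _ _ _ f m
    change pair f (ev η m) = pair (idEl (𝟙 _)) (ev η (r _ (idHom f) m))
    rw [ev_r, ← pair_l, l_idEl_id]
  whiskerRight_comp _ _ _ := by
    refine comp_hom_ext ?_
    intro _ _ _ x m
    obtain ⟨b, p, n, rfl⟩ := pair_surj x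
    rfl
  whisker_assoc _ _ _ _ _ := by
    refine comp_hom_ext ?_
    intro _ _ _ p x
    obtain ⟨b, n, m, rfl⟩ := pair_surj x
    rfl
  whisker_exchange _ _ := by
    refine comp_hom_ext ?_
    intros
    rfl
  pentagon M N P Q := by
    refine comp_hom_ext ?_
    intro _ _ _ q x
    obtain ⟨_, p, y, rfl⟩ := pair_surj x
    obtain ⟨_, n, m, rfl⟩ := pair_surj y
    rfl
  triangle M N := by
    refine comp_hom_ext ?_
    intro _ _ _ n x
    obtain ⟨_, f, m, rfl⟩ := pair_surj x
    exact pair_l (idHom f) n m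

/-! ### The category of elements of a category enriched in lex profunctors -/

/-- Objects of the category `∫ C`: pairs `(X, i)` with `X` an object of `C` of extent `A` and
`i` an object of `A`. -/
structure ElementsCat (C : BicatEnrichedCat.{w} LexProf.{u}) : Type (max w (u + 1)) where
  {extent : LexProf.{u}}
  obj : C.Obj extent
  elt : extent

namespace ElementsCat

open LexProfunctor

variable (C : BicatEnrichedCat.{w} LexProf.{u})

/-- The set `C(X, Y)(i, j)`. -/
def homEl {A B : LexProf.{u}} (X : C.Obj A) (Y : C.Obj B) (i : A) (j : B) : Type u :=
  LexProfunctor.el (A := A) (B := B) (C.hom X Y) i j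

/-- The composition functions `C(Y, Z)(j, k) × C(X, Y)(i, j) → C(X, Z)(i, k)`. -/
def compose {A B D : LexProf.{u}} {X : C.Obj A} {Y : C.Obj B} {Z : C.Obj D} {i : A} {j : B} {k : D}
    (g : homEl C Y Z j k) (f : homEl C X Y i j) : homEl C X Z i k :=
  ev (C.comp X Y Z) (pair g f)

/-- The identities map `A(i, j) → C(X, X)(i, j)`. -/
def idMap {A : LexProf.{u}} (X : C.Obj A) {i j : A} (φ : i ⟶ j) : homEl C X X i j :=
  ev (C.id X) (idEl φ)

variable {C}

lemma compose_assoc {A B D E : LexProf.{u}} {X : C.Obj A} {Y : C.Obj B} {Z : C.Obj D} {T : C.Obj E}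
    {i : A} {j : B} {k : D} {m : E} (h : homEl C Z T k m) (g : homEl C Y Z j k)
    (f : homEl C X Y i j) : compose C h (compose C g f) = compose C (compose C h g) f :=
  congrArg (fun α => ev α (pair (M := compProf _ _) h (pair g f))) (C.assoc X Y Z T)

lemma compose_idMap {A B : LexProf.{u}} {X : C.Obj A} {Y : C.Obj B} {i i' : A} {j : B}
    (f : homEl C X Y i j) (φ : i' ⟶ i) : compose C f (idMap C X φ) = LexProfunctor.l _ φ f :=
  congrArg (fun α => ev α (pair f (idEl φ))) (C.id_comp X Y)

lemma idMap_compose {A B : LexProf.{u}} {X : C.Obj A} {Y : C.Obj B} {i : A} {j j' : B}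
    (ψ : j ⟶ j') (f : homEl C X Y i j) : compose C (idMap C Y ψ) f = LexProfunctor.r _ ψ f :=
  congrArg (fun α => ev α (pair (idEl ψ) f)) (C.comp_id X Y)

instance : Category.{u} (ElementsCat C) where
  Hom P Q := homEl C P.obj Q.obj P.elt Q.elt
  id P := idMap C P.obj (𝟙 P.elt)
  comp f g := compose C g f
  id_comp f := (compose_idMap f _).trans (LexProfunctor.l_id _ f)
  comp_id f := (idMap_compose _ f).trans (LexProfunctor.r_id _ f)
  assoc f g h := compose_assoc h g f

/-- The functor `ι_X : A ⥤ ∫ C` sending `i` to `(X, i)`, for `X` of extent `A`. -/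
def incl {A : LexProf.{u}} (X : C.Obj A) : (A : Type u) ⥤ ElementsCat C where
  obj i := ⟨X, i⟩
  map φ := idMap C X φ
  map_id _ := rfl
  map_comp φ ψ :=
    (ev_r (C.id X) ψ (idEl φ)).trans (idMap_compose ψ (idMap C X φ)).symm

end ElementsCat

/-!
The theorem identifies the absolute tensors in the world of lex profunctors: tensors by
`V : A ⟶ B` are absolute exactly when `V(a, b) ≅ A(a, F b)`, naturally, for some functor
`F : B ⥤ A`, which then preserves finite limits because `V` does so in its second variable.

Suppose that `V` is represented by `F`. By the Yoneda lemma, maps `V ⟶ C(X, Y)` are natural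
transformations `ι_X ∘ F ⟶ ι_Y`, and such a map is a tensor if and only if the transformation is
invertible (`ElementsCat.isTensor_of_isIso`, `ElementsCat.isIso_of_isTensor`): an inverse is a map
`V* ⟶ C(Y, X)` out of the left adjoint `V*(b, a) = A(F b, a)` of `V`, and the universal property
of the tensor produces it from the counit of the adjunction. Enriched functors preserve
isomorphisms, so tensors by `V` are absolute, and to give a tensor of `X` by `V` is to give `Y`
with `ι_X ∘ F ≅ ι_Y` (`ElementsCat.exists_isTensor_iff`).

Conversely, suppose that tensors by `V` are absolute. For any category `E`, the
finite-limit-preserving functors from small categories to `E` form a category `lexFunctors E`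
enriched in lex profunctors, with hom-objects `(i, j) ↦ E(G i, H j)`. For `E` the category of
presheaves on `A`, the functor `b ↦ V(-, b)` is the tensor of the Yoneda embedding by `V`
(`LexProfunctor.isTensor_yonedaTensor`). This tensor is preserved by the enriched functor to
`lexFunctors Type` induced by `Hom(V(-, b), -)`. Comparing it with the coend
`∫^a V(a, -) × Hom(V(-, b), A(-, a))` shows that the identity of `V(-, b)` factors through some
`A(-, a)` (`LexProfunctor.exists_section_of_tensorsAreAbsolute`). Since `A` has equalizers, the
retract `V(-, b)` of a representable is itself representable, and hence `V` is represented by a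
functor (`LexProfunctor.nonempty_representation_of_tensorsAreAbsolute`).
-/

/-! ### Represented lex profunctors -/

namespace LexProfunctor

variable {A B : LexProf.{u}}

/-- A representation of a lex profunctor `V` by a functor `F : B ⥤ A`: an isomorphism
`A(a, F b) ≅ V(a, b)`, natural in `a` and `b`, encoded by the images `elt b` of the identities. -/
structure Representation (V : LexProfunctor A B) where
  F : (B : Type u) ⥤ (A : Type u)
  elt : ∀ b : B, V.el (F.obj b) b
  natural : ∀ {b b' : B} (g : b ⟶ b'), V.l (F.map g) (elt b') = V.r g (elt b)
  bijective : ∀ (a : A) (b : B), Function.Bijective fun f : a ⟶ F.obj b => V.l f (elt b)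

namespace Representation

variable {V : LexProfunctor A B} (R : Representation V)

/-- The morphism `a ⟶ F b` classifying an element of `V(a, b)`. -/
noncomputable def lift {a : A} {b : B} (x : V.el a b) : a ⟶ R.F.obj b :=
  ((R.bijective a b).2 x).choose

@[simp] lemma l_lift {a : A} {b : B} (x : V.el a b) : V.l (R.lift x) (R.elt b) = x :=
  ((R.bijective a b).2 x).choose_spec

lemma hom_ext {a : A} {b : B} {f g : a ⟶ R.F.obj b} (h : V.l f (R.elt b) = V.l g (R.elt b)) :
    f = g := (R.bijective a b).1 h

@[simp] lemma lift_elt (b : B) : R.lift (R.elt b) = 𝟙 _ := R.hom_ext (by simp)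

@[simp] lemma lift_l {a a' : A} {b : B} (f : a' ⟶ a) (x : V.el a b) :
    R.lift (V.l f x) = f ≫ R.lift x := R.hom_ext (by simp [l_comp])

@[simp] lemma lift_r {a : A} {b b' : B} (g : b ⟶ b') (x : V.el a b) :
    R.lift (V.r g x) = R.lift x ≫ R.F.map g :=
  R.hom_ext (by simp [l_comp, R.natural, l_r])

/-- A functor representing a lex profunctor preserves finite limits, since each composite
`A(a, F -) ≅ V(a, -)` does. -/
lemma preservesFiniteLimits : PreservesFiniteLimits R.F := by
  have key (a : (A : Type u)ᵒᵖ) : PreservesFiniteLimits (R.F ⋙ coyoneda.obj a) := by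
    have := V.lex a
    refine preservesFiniteLimits_of_natIso (F := V.functor.obj a)
      (NatIso.ofComponents (fun b => Equiv.toIso (Equiv.ofBijective
        (fun f => V.l f (R.elt b)) (R.bijective a.unop b)).symm) ?_)
    intro b b' g
    ext x
    refine R.hom_ext (a := a.unop) ?_
    obtain ⟨f, rfl⟩ := (R.bijective a.unop b).2 x
    refine (Equiv.ofBijective_apply_symm_apply _ (R.bijective a.unop b') _).trans ?_
    refine ((l_r (M := V) f g (R.elt b)).symm.trans ?_).trans
      (congrArg (fun h => V.l (h ≫ R.F.map g) (R.elt b'))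
        (Equiv.ofBijective_symm_apply_apply _ (R.bijective a.unop b) f).symm)
    rw [l_comp, R.natural]
  -- The functors `A(a, -)` jointly reflect limits.
  refine ⟨fun J _ _ => ⟨fun {K} => ⟨fun {c} hc => ⟨coyonedaJointlyReflectsLimits _ _ fun a => ?_⟩⟩⟩⟩
  have := key a
  exact isLimitOfPreserves (R.F ⋙ coyoneda.obj a) hc

/-- The lex profunctor `(a, b) ↦ B(F a, b)` of a functor `F : A ⥤ B`. When `F` preserves finite
limits, it is left adjoint to `represented F`. -/
def corepresented (F : (A : Type u) ⥤ (B : Type u)) : LexProfunctor A B where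
  functor := F.op ⋙ coyoneda
  lex a := inferInstanceAs (PreservesFiniteLimits (coyoneda.obj (op (F.obj a.unop))))

/-- The lex profunctor `(b, a) ↦ B(b, F a)` of a functor `F : A ⥤ B` preserving finite limits. -/
def represented (F : (A : Type u) ⥤ (B : Type u)) [PreservesFiniteLimits F] :
    LexProfunctor B A where
  functor := coyoneda ⋙ (Functor.whiskeringLeft (A : Type u) (B : Type u) (Type u)).obj F
  lex b := inferInstanceAs (PreservesFiniteLimits (F ⋙ coyoneda.obj b))

/-- The tautological representation of `(b, a) ↦ B(b, F a)`. -/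
def ofFunctor (F : (A : Type u) ⥤ (B : Type u)) [PreservesFiniteLimits F] :
    Representation (represented F) where
  F := F
  elt b := 𝟙 (F.obj b)
  natural g := (Category.comp_id (F.map g)).trans (Category.id_comp (F.map g)).symm
  bijective a b := by
    have h : (fun f : a ⟶ F.obj b =>
        (represented F).l f (𝟙 (F.obj b) : (represented F).el (F.obj b) b)) = id :=
      funext fun f => Category.comp_id f
    rw [h]
    exact Function.bijective_id

end Representation

end LexProfunctor

/-! ### Maps of hom-objects as families of morphisms of `∫ C` -/

namespace ElementsCat

open LexProfunctor

variable {C : BicatEnrichedCat.{w} LexProf.{u}} {A B D : LexProf.{u}}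

/-- The family of morphisms `(X, i) ⟶ (Y, j)` indexed by elements of `M(i, j)` that corresponds
to a map `M ⟶ C(X, Y)`. -/
def arrow {X : C.Obj A} {Y : C.Obj B} {M : A ⟶ B} (t : M ⟶ C.hom X Y) {i : A} {j : B}
    (m : LexProfunctor.el (A := A) (B := B) M i j) : (incl X).obj i ⟶ (incl Y).obj j :=
  ev (A := A) (B := B) t m

lemma arrow_l {X : C.Obj A} {Y : C.Obj B} {M : A ⟶ B} (t : M ⟶ C.hom X Y) {i i' : A} {j : B}
    (φ : i' ⟶ i) (m : LexProfunctor.el (A := A) (B := B) M i j) :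
    arrow t (LexProfunctor.l _ φ m) = (incl X).map φ ≫ arrow t m :=
  (ev_l (A := A) (B := B) t φ m).trans (compose_idMap (ev (A := A) (B := B) t m) φ).symm

lemma arrow_r {X : C.Obj A} {Y : C.Obj B} {M : A ⟶ B} (t : M ⟶ C.hom X Y) {i : A} {j j' : B}
    (φ : j ⟶ j') (m : LexProfunctor.el (A := A) (B := B) M i j) :
    arrow t (LexProfunctor.r _ φ m) = arrow t m ≫ (incl Y).map φ :=
  (ev_r (A := A) (B := B) t φ m).trans (idMap_compose φ (ev (A := A) (B := B) t m)).symm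

lemma arrow_ext {X : C.Obj A} {Y : C.Obj B} {M : A ⟶ B} {s t : M ⟶ C.hom X Y}
    (h : ∀ (i : A) (j : B) (m : LexProfunctor.el (A := A) (B := B) M i j),
      arrow s m = arrow t m) : s = t :=
  LexProfunctor.hom_ext (A := A) (B := B) h

/-- Maps `M ⟶ C(X, Y)` are natural families of morphisms `(X, i) ⟶ (Y, j)`. -/
def ofArrows {X : C.Obj A} {Y : C.Obj B} (M : A ⟶ B)
    (f : ∀ (i : A) (j : B), LexProfunctor.el (A := A) (B := B) M i j →
      ((incl X).obj i ⟶ (incl Y).obj j))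
    (hl : ∀ {i i' : A} (φ : i' ⟶ i) {j : B} (m : LexProfunctor.el (A := A) (B := B) M i j),
      f i' j (LexProfunctor.l _ φ m) = (incl X).map φ ≫ f i j m)
    (hr : ∀ {i : A} {j j' : B} (φ : j ⟶ j') (m : LexProfunctor.el (A := A) (B := B) M i j),
      f i j' (LexProfunctor.r _ φ m) = f i j m ≫ (incl Y).map φ) : M ⟶ C.hom X Y :=
  homMk (A := A) (B := B) M (C.hom X Y) f
    (fun φ _ m => (hl φ m).trans (compose_idMap (C := C) (X := X) (Y := Y) (f _ _ m) φ))
    (fun φ m => (hr φ m).trans (idMap_compose (C := C) (X := X) (Y := Y) φ (f _ _ m)))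

@[simp] lemma arrow_ofArrows {X : C.Obj A} {Y : C.Obj B} (M : A ⟶ B) (f) (hl) (hr) {i : A} {j : B}
    (m : LexProfunctor.el (A := A) (B := B) M i j) :
    arrow (ofArrows (X := X) (Y := Y) M f hl hr) m = f i j m := rfl

/-- The map `V ≫ U ⟶ C(X, Z)` induced by `t : V ⟶ C(X, Y)` and `f : U ⟶ C(Y, Z)`, computed on
representatives. -/
lemma arrow_tensor {X : C.Obj A} {Y : C.Obj B} {Z : C.Obj D} {V : A ⟶ B} {U : B ⟶ D}
    (t : V ⟶ C.hom X Y) (f : U ⟶ C.hom Y Z) {a : A} {b : B} {d : D}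
    (m : LexProfunctor.el (A := B) (B := D) U b d) (v : LexProfunctor.el (A := A) (B := B) V a b) :
    arrow (V ◁ f ≫ t ▷ C.hom Y Z ≫ C.comp X Y Z) (pair (M := V) (N := U) m v) =
      arrow t v ≫ arrow f m := rfl

/-! ### Tensors by represented lex profunctors -/

section tensors

variable {V : A ⟶ B} (R : Representation (A := A) (B := B) V) {X : C.Obj A} {Y : C.Obj B}

/-- By the Yoneda lemma, a map from a represented lex profunctor is determined by its values at
the universal elements. -/
lemma arrow_eq_lift (t : V ⟶ C.hom X Y) {a : A} {b : B}
    (v : LexProfunctor.el (A := A) (B := B) V a b) :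
    arrow t v = (incl X).map (R.lift v) ≫ arrow t (R.elt b) := by
  rw [← arrow_l, R.l_lift]

/-- By the Yoneda lemma, a map `V ⟶ C(X, Y)` out of a represented lex profunctor is a natural
transformation `ι_X ∘ F ⟶ ι_Y`. -/
def toNatTrans (t : V ⟶ C.hom X Y) : R.F ⋙ incl X ⟶ incl Y where
  app b := arrow t (R.elt b)
  naturality b b' g := by
    rw [← arrow_r, ← R.natural, arrow_l]
    rfl

/-- The map `V ⟶ C(X, Y)` corresponding to a natural transformation `ι_X ∘ F ⟶ ι_Y`. -/
noncomputable def ofNatTrans (τ : R.F ⋙ incl X ⟶ incl Y) : V ⟶ C.hom X Y :=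
  ofArrows V (fun _ b v => (incl X).map (R.lift v) ≫ τ.app b)
    (fun φ b v => by rw [R.lift_l, Functor.map_comp, Category.assoc])
    (fun φ v => by
      rw [R.lift_r, Functor.map_comp, Category.assoc, Category.assoc, ← τ.naturality]
      rfl)

lemma arrow_ofNatTrans_elt (τ : R.F ⋙ incl X ⟶ incl Y) (b : B) :
    arrow (ofNatTrans R τ) (R.elt b) = τ.app b := by
  simp [ofNatTrans]

/-- If `t` corresponds to a natural isomorphism `ι_X ∘ F ≅ ι_Y`, then it is a tensor: the map
`U ⟶ C(Y, Z)` corresponding to `g : V ≫ U ⟶ C(X, Z)` sends `m` to the composite of `g (m, R.elt b)`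
with the inverse of the isomorphism. -/
theorem isTensor_of_isIso (t : V ⟶ C.hom X Y) (ht : ∀ b : B, IsIso (arrow t (R.elt b))) :
    C.IsTensor X V Y t := by
  intro D U Z
  constructor
  · intro f f' h
    refine arrow_ext fun b d m => ?_
    rw [← cancel_epi (arrow t (R.elt b))]
    exact (arrow_tensor t f m (R.elt b)).symm.trans ((congrArg (fun s => arrow s
      (pair (M := V) (N := U) m (R.elt b))) h).trans (arrow_tensor t f' m (R.elt b)))
  · intro g
    refine ⟨ofArrows U (fun b d m => inv (arrow t (R.elt b)) ≫
      arrow g (pair (M := V) (N := U) m (R.elt b))) ?_ ?_, ?_⟩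
    · intro b b' φ d m
      rw [IsIso.inv_comp_eq, pair_l, ← R.natural, ← compProf_l]
      refine (arrow_l (X := X) (Y := Z) g _ _).trans ?_
      rw [← Category.assoc, ← Category.assoc, ← arrow_r, ← R.natural, arrow_l,
        Category.assoc ((incl X).map _), IsIso.hom_inv_id, Category.comp_id]
    · intro b d d' φ m
      rw [← compProf_r, Category.assoc]
      exact congrArg _ (arrow_r (X := X) (Y := Z) g _ _)
    · refine arrow_ext fun a d x => ?_
      obtain ⟨b, m, v, rfl⟩ := pair_surj (M := V) (N := U) x
      refine (arrow_tensor t _ m v).trans ?_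
      rw [arrow_ofArrows, arrow_eq_lift R t v, Category.assoc, IsIso.hom_inv_id_assoc]
      refine (arrow_l (X := X) (Y := Z) g _ _).symm.trans ?_
      exact congrArg (arrow g) ((compProf_l (M := V) (N := U) _ m _).trans
        (congrArg (pair (M := V) (N := U) m) (R.l_lift v)))

/-- A tensor by a lex profunctor represented by `F` corresponds to a natural isomorphism
`ι_X ∘ F ≅ ι_Y`. The inverse comes from the universal property of the tensor at the left adjoint
`(b, a) ↦ A(F b, a)` of `V`. -/
theorem isIso_of_isTensor (t : V ⟶ C.hom X Y) (ht : C.IsTensor X V Y t) (b : B) :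
    IsIso (arrow t (R.elt b)) := by
  let N : B ⟶ A := Representation.corepresented (A := B) (B := A) R.F
  -- The counit of the adjunction, followed by the identities map of `C` at `X`.
  let counit : V ≫ N ⟶ C.hom X X := descHom (M := V) (N := N) (C.hom X X)
    (fun a b a' k v => (incl X).map (R.lift v ≫ k))
    (fun {a b b' a'} g (k : R.F.obj b' ⟶ a') v => by
      change (incl X).map (R.lift v ≫ R.F.map g ≫ k) = _
      rw [R.lift_r, Category.assoc])
    (fun {a a' b c} g (k : R.F.obj b ⟶ c) v => by
      rw [R.lift_l, Category.assoc, Functor.map_comp]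
      exact compose_idMap (C := C) (X := X) (Y := X) ((incl X).map (R.lift v ≫ k)) g)
    (fun {a b c c'} g (k : R.F.obj b ⟶ c) v => by
      change (incl X).map (R.lift v ≫ k ≫ g) = _
      rw [← Category.assoc, Functor.map_comp]
      exact idMap_compose (C := C) (X := X) (Y := X) g ((incl X).map (R.lift v ≫ k)))
  obtain ⟨s, hs⟩ := (ht N X).2 counit
  have hst {a a' : A} {b : B} (v : LexProfunctor.el (A := A) (B := B) V a b)
      (k : R.F.obj b ⟶ a') : arrow t v ≫ arrow s (j := a') k = (incl X).map (R.lift v ≫ k) :=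
    congrArg (fun q => arrow q (pair (M := V) (N := N) (c := a') k v)) hs
  let σ (b : B) : (incl Y).obj b ⟶ (incl X).obj (R.F.obj b) :=
    arrow s (j := R.F.obj b) (𝟙 (R.F.obj b))
  have σ_natural {b b' : B} (φ : b ⟶ b') :
      (incl Y).map φ ≫ σ b' = σ b ≫ (incl X).map (R.F.map φ) := by
    refine (arrow_l (M := N) s φ _).symm.trans (Eq.trans ?_ (arrow_r (M := N) s (R.F.map φ) _))
    exact congrArg (fun k : R.F.obj b ⟶ R.F.obj b' => arrow s k)
      ((Category.comp_id _).trans (Category.id_comp _).symm)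
  -- Both composites of `arrow t (R.elt b)` and `σ b` are identities: the first by construction,
  -- the second by the uniqueness part of the universal property.
  refine ⟨σ b, ?_, ?_⟩
  · rw [hst (R.elt b) (𝟙 _), Category.comp_id, R.lift_elt, CategoryTheory.Functor.map_id]
  · -- Precomposed with `t`, the maps `e` and `C.id Y` agree.
    let e : 𝟙 B ⟶ C.hom Y Y := ofArrows (X := Y) (Y := Y) (𝟙 B)
      (fun b b' φ => σ b ≫ (incl X).map (R.F.map (idHom φ)) ≫ arrow t (R.elt b'))
      (fun {b b'} g {c} (φ : b ⟶ c) => by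
        change σ b' ≫ (incl X).map (R.F.map (g ≫ φ)) ≫ arrow t (R.elt c) = _
        rw [R.F.map_comp, Functor.map_comp, ← Category.assoc (_ : _ ⟶ _) (σ b), σ_natural]
        simp only [Category.assoc]
        rfl)
      (fun {b c c'} g (φ : b ⟶ c) => by
        change σ b ≫ (incl X).map (R.F.map (φ ≫ g)) ≫ arrow t (R.elt c') = _
        rw [Category.assoc, Category.assoc, ← arrow_r, ← R.natural, arrow_l, R.F.map_comp,
          Functor.map_comp, Category.assoc]
        rfl)
    have he : e = C.id Y := by
      refine (ht (𝟙 B) Y).1 (arrow_ext fun a c x => ?_)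
      obtain ⟨b, φ, v, rfl⟩ := pair_surj (M := V) (N := idProf B) x
      refine (arrow_tensor t e φ v).trans (Eq.trans ?_ (arrow_tensor t (C.id Y) φ v).symm)
      change arrow t v ≫ σ b ≫ (incl X).map (R.F.map (idHom φ)) ≫ arrow t (R.elt c) =
        arrow t v ≫ (incl Y).map (idHom φ)
      rw [← arrow_r, arrow_eq_lift R t (LexProfunctor.r _ _ v), R.lift_r, ← Category.assoc,
        hst v (𝟙 _), Category.comp_id, Functor.map_comp, Category.assoc]
    have := congrArg (fun q : 𝟙 B ⟶ C.hom Y Y => arrow q (idEl (𝟙 b))) he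
    change σ b ≫ (incl X).map (R.F.map (𝟙 b)) ≫ arrow t (R.elt b) = (incl Y).map (𝟙 b) at this
    rw [R.F.map_id, CategoryTheory.Functor.map_id, CategoryTheory.Functor.map_id] at this
    exact (congrArg (σ b ≫ ·) (Category.id_comp (arrow t (R.elt b))).symm).trans this

/-- An object `Y` with a natural isomorphism `ι_X ∘ F ≅ ι_Y` is the same as a tensor of `X` by
the lex profunctor represented by `F`. -/
theorem exists_isTensor_iff (X : C.Obj A) (Y : C.Obj B) :
    (∃ t : V ⟶ C.hom X Y, C.IsTensor X V Y t) ↔ Nonempty (R.F ⋙ incl X ≅ incl Y) := by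
  constructor
  · rintro ⟨t, ht⟩
    have (b : B) : IsIso ((toNatTrans R t).app b) := isIso_of_isTensor R t ht b
    have := NatIso.isIso_of_isIso_app (toNatTrans R t)
    exact ⟨asIso (toNatTrans R t)⟩
  · rintro ⟨τ⟩
    refine ⟨ofNatTrans R τ.hom, isTensor_of_isIso R _ fun b => ?_⟩
    rw [arrow_ofNatTrans_elt]
    infer_instance

end tensors

/-! ### Absoluteness of tensors by represented lex profunctors -/

/-- The functor `∫ C ⥤ ∫ D` induced by an enriched functor `C ⟶ D`. -/
def mapElements {C D : BicatEnrichedCat.{w} LexProf.{u}} (F : BicatEnrichedFunctor C D) :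
    ElementsCat C ⥤ ElementsCat D where
  obj P := ⟨F.obj P.obj, P.elt⟩
  map {P Q} f := ev (A := P.extent) (B := Q.extent) (F.map P.obj Q.obj) f
  map_id P := congrArg (fun q : 𝟙 P.extent ⟶ D.hom (F.obj P.obj) (F.obj P.obj) =>
    arrow q (idEl (𝟙 P.elt))) (F.map_id P.obj)
  map_comp {P Q S} f g := congrArg (fun q => arrow (M := C.hom P.obj Q.obj ≫ C.hom Q.obj S.obj)
    q (pair (M := C.hom P.obj Q.obj) (N := C.hom Q.obj S.obj) g f))
      (F.map_comp P.obj Q.obj S.obj)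

/-- Tensors by a represented lex profunctor are absolute, since they amount to isomorphisms. -/
theorem tensorsAreAbsolute_of_representation {V : A ⟶ B}
    (R : Representation (A := A) (B := B) V) : TensorsAreAbsolute.{w} V := by
  intro C D F X Y t ht
  refine isTensor_of_isIso R _ fun b => ?_
  have := isIso_of_isTensor R t ht b
  exact inferInstanceAs (IsIso ((mapElements F).map (arrow t (R.elt b))))

end ElementsCat

/-! ### Enriched categories of lex functors -/

namespace LexProfunctor

section lexFunctors

variable {A B : LexProf.{u}} {E : Type (u + 1)} [Category.{u} E]
  {E' : Type (u + 1)} [Category.{u} E']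

/-- A finite-limit-preserving functor from `A` to the category `E`. The universe parameter `w`
places the collection of these functors in a universe as large as needed. -/
structure LexFunctor (A : LexProf.{u}) (E : Type (u + 1)) [Category.{u} E] :
    Type (max w (u + 1)) where
  functor : (A : Type u) ⥤ E
  [lex : PreservesFiniteLimits functor]

attribute [instance] LexFunctor.lex

/-- The lex profunctor `(a, b) ↦ E(G a, H b)`. -/
def homProf (G : (A : Type u) ⥤ E) (H : (B : Type u) ⥤ E) [PreservesFiniteLimits H] :
    LexProfunctor A B where
  functor := G.op ⋙ coyoneda ⋙ (Functor.whiskeringLeft (B : Type u) E (Type u)).obj H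
  lex a := inferInstanceAs (PreservesFiniteLimits (H ⋙ coyoneda.obj (op (G.obj a.unop))))

/-- A morphism `G a ⟶ H b` as an element of `homProf G H`. -/
def homProfEl {G : (A : Type u) ⥤ E} {H : (B : Type u) ⥤ E} [PreservesFiniteLimits H]
    {a : A} {b : B} (f : G.obj a ⟶ H.obj b) : (homProf G H).el a b := f

/-- An element of `homProf G H` as a morphism `G a ⟶ H b`. -/
def homProfHom {G : (A : Type u) ⥤ E} {H : (B : Type u) ⥤ E} [PreservesFiniteLimits H]
    {a : A} {b : B} (f : (homProf G H).el a b) : G.obj a ⟶ H.obj b := f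

/-- Finite-limit-preserving functors from small categories into a fixed category `E` are the
objects of a category enriched in lex profunctors. -/
def lexFunctors (E : Type (u + 1)) [Category.{u} E] :
    BicatEnrichedCat.{max w (u + 1)} LexProf.{u} where
  Obj A := LexFunctor.{w} A E
  hom G H := homProf G.functor H.functor
  comp G H K := descHom (M := homProf G.functor H.functor) (N := homProf H.functor K.functor)
    (homProf G.functor K.functor) (fun _ _ _ n m => homProfEl (homProfHom m ≫ homProfHom n))
    (fun _ _ _ => (Category.assoc _ _ _).symm) (fun _ _ _ => Category.assoc _ _ _)
    (fun _ _ _ => (Category.assoc _ _ _).symm)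
  id G := homMk (idProf _) (homProf G.functor G.functor)
    (fun _ _ f => homProfEl (G.functor.map (idHom f)))
    (fun _ _ _ => G.functor.map_comp _ _) (fun _ _ => G.functor.map_comp _ _)
  id_comp _ _ := by
    refine comp_hom_ext ?_
    intros
    rfl
  comp_id _ _ := by
    refine comp_hom_ext ?_
    intros
    rfl
  assoc G H K L := by
    refine comp_hom_ext ?_
    intro _ _ _ p x
    obtain ⟨_, n, m, rfl⟩ := pair_surj x
    exact Category.assoc (homProfHom m) (homProfHom n) (homProfHom p)

/-- Restates `LexFunctor.lex` for objects of `lexFunctors E`, whose type is only definitionally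
that of lex functors. -/
instance (G : (lexFunctors.{w} E).Obj A) : PreservesFiniteLimits (LexFunctor.functor G) :=
  LexFunctor.lex G

/-- Postcomposition with a finite-limit-preserving functor. -/
def lexFunctorsMap (Φ : E ⥤ E') [PreservesFiniteLimits Φ] :
    BicatEnrichedFunctor (lexFunctors.{w} E) (lexFunctors.{w} E') where
  obj G := ⟨LexFunctor.functor G ⋙ Φ⟩
  map G H := homMk (homProf (LexFunctor.functor G) (LexFunctor.functor H))
    (homProf (LexFunctor.functor G ⋙ Φ) (LexFunctor.functor H ⋙ Φ))
    (fun _ _ f => homProfEl (Φ.map (homProfHom f)))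
    (fun _ _ _ => Φ.map_comp _ _) (fun _ _ => Φ.map_comp _ _)
  map_id _ := rfl
  map_comp G H K := by
    refine comp_hom_ext ?_
    intro _ _ _ n m
    exact Φ.map_comp (homProfHom m) (homProfHom n)

end lexFunctors

/-! ### The tensor of the Yoneda embedding -/

variable {A B : LexProf.{u}} (V : LexProfunctor A B)

/-- The presheaves `V(-, b)` as a finite-limit-preserving functor of `b`. -/
def presheaves : LexFunctor.{w} B ((A : Type u)ᵒᵖ ⥤ Type u) where
  functor := V.functor.flip
  lex := ⟨fun J _ _ => preservesLimitsOfShape_of_evaluation _ J fun a =>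
    have := V.lex a
    inferInstanceAs (PreservesLimitsOfShape J (V.functor.obj a))⟩

/-- The Yoneda embedding of `A` as a finite-limit-preserving functor. -/
def yonedaLex (A : LexProf.{u}) : LexFunctor.{w} A ((A : Type u)ᵒᵖ ⥤ Type u) where
  functor := yoneda

/-- The functor `V(a, -)`. -/
def row (a : A) : LexFunctor.{w} B (Type u) where
  functor := V.functor.obj (op a)
  lex := V.lex (op a)

variable {V}

/-- The map of presheaves `A(-, a) ⟶ V(-, b)` corresponding to an element of `V(a, b)`. -/
def yonedaMap {a : A} {b : B} (v : V.el a b) : yoneda.obj a ⟶ V.functor.flip.obj b where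
  app a' := ↾fun f : a'.unop ⟶ a => V.l f v
  naturality a' a'' g := by
    ext f
    exact V.l_comp g.unop f v

variable (V)

/-- The Yoneda correspondence, as a map from `V` to a hom-object of `lexFunctors`. -/
def yonedaTensor : V ⟶ homProf (yonedaLex.{w} A).functor (V.presheaves.{w}).functor :=
  homMk V (homProf (yonedaLex.{w} A).functor (V.presheaves.{w}).functor)
    (fun _ _ v => homProfEl (yonedaMap v))
    (fun g _ v => NatTrans.ext (funext fun a' => by ext f; exact (V.l_comp f g v).symm))
    (fun g v => NatTrans.ext (funext fun a' => by ext f; exact V.l_r f g v))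

/-- The presheaves `V(-, b)` are the tensor by `V` of the Yoneda embedding: by the Yoneda lemma,
maps `U(b, d) × V(a, b) → Hom(A(-, a), Z d)` are the same as maps
`U(b, d) → Hom(V(-, b), Z d)`. -/
theorem isTensor_yonedaTensor :
    (lexFunctors.{w} ((A : Type u)ᵒᵖ ⥤ Type u)).IsTensor (x := A) (y := B)
      (yonedaLex.{w} A) V V.presheaves.{w} V.yonedaTensor := by
  intro D U Z
  constructor
  · intro f f' h
    refine LexProfunctor.hom_ext (A := B) (B := D) fun b d m => ?_
    refine NatTrans.ext (funext fun a => ?_)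
    ext (v : V.el a.unop b)
    have hv := congrArg (fun s => homProfHom
      (ev (A := A) (B := D) s (pair (M := V) (N := U) m v))) h
    have key (k : U ⟶ (lexFunctors _).hom V.presheaves Z) :
        NatTrans.app (homProfHom (ev (A := B) (B := D) k m)) a v =
          NatTrans.app (yonedaMap v ≫ homProfHom (ev (A := B) (B := D) k m)) a (𝟙 a.unop) :=
      congrArg (NatTrans.app (homProfHom (ev (A := B) (B := D) k m)) a) (V.l_id v).symm
    exact (key f).trans ((ConcreteCategory.congr_hom (NatTrans.congr_app hv a)
      (𝟙 a.unop)).trans (key f').symm)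
  · intro g
    -- `f` sends `m` to the transformation `V(-, b) ⟶ Z d` with `v ↦ g (m, v) (𝟙 a)`.
    let γ {a : A} {b : B} {d : D} (m : LexProfunctor.el (A := B) (B := D) U b d)
        (v : V.el a b) : yoneda.obj a ⟶ (LexFunctor.functor Z).obj d :=
      homProfHom (ev (A := A) (B := D) g (pair (M := V) (N := U) m v))
    have γ_l {a a' : A} {b : B} {d : D} (m : LexProfunctor.el (A := B) (B := D) U b d)
        (k : a' ⟶ a) (v : V.el a b) : γ m (V.l k v) = yoneda.map k ≫ γ m v :=
      (congrArg (ev (A := A) (B := D) g) (compProf_l (M := V) (N := U) k m v).symm).trans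
        (ev_l (A := A) (B := D) g k _)
    have γ_r {a : A} {b : B} {d d' : D} (m : LexProfunctor.el (A := B) (B := D) U b d)
        (φ : d ⟶ d') (v : V.el a b) :
        γ (LexProfunctor.r U φ m) v = γ m v ≫ (LexFunctor.functor Z).map φ :=
      (congrArg (ev (A := A) (B := D) g) (compProf_r (M := V) (N := U) φ m v).symm).trans
        (ev_r (A := A) (B := D) g φ _)
    have γ_pair {a : A} {b b' : B} {d : D} (m : LexProfunctor.el (A := B) (B := D) U b d)
        (φ : b' ⟶ b) (v : V.el a b') : γ (LexProfunctor.l U φ m) v = γ m (V.r φ v) :=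
      congrArg (ev (A := A) (B := D) g) (pair_l (M := V) (N := U) φ m v)
    have γ_app {a a' : A} {b : B} {d : D} (m : LexProfunctor.el (A := B) (B := D) U b d)
        (k : a' ⟶ a) (v : V.el a b) :
        (γ m (V.l k v)).app (op a') (𝟙 a') = (γ m v).app (op a') k := by
      rw [γ_l]
      exact congrArg ((γ m v).app (op a')) (Category.id_comp k)
    let f : U ⟶ homProf V.presheaves.functor (LexFunctor.functor Z) :=
      homMk (A := B) (B := D) U (homProf V.presheaves.functor (LexFunctor.functor Z))
        (fun b d m => homProfEl
          { app := fun a => ↾fun v : V.el a.unop b => (γ m v).app a (𝟙 a.unop)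
            naturality := fun a a' k => by
              ext (v : V.el a.unop b)
              refine (γ_app m k.unop v).trans (Eq.trans ?_
                (ConcreteCategory.congr_hom ((γ m v).naturality k) (𝟙 a.unop)))
              exact congrArg ((γ m v).app a') (Category.comp_id k.unop).symm })
        (fun φ d m => NatTrans.ext (funext fun a => by
          ext (v : V.el a.unop _)
          exact congrArg (fun δ : yoneda.obj a.unop ⟶ (LexFunctor.functor Z).obj d =>
            δ.app a (𝟙 a.unop)) (γ_pair m φ v)))
        (fun φ m => NatTrans.ext (funext fun a => by
          ext (v : V.el a.unop _)
          exact congrArg (fun δ : yoneda.obj a.unop ⟶ (LexFunctor.functor Z).obj _ =>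
            δ.app a (𝟙 a.unop)) (γ_r m φ v)))
    refine ⟨f, LexProfunctor.hom_ext (A := A) (B := D) fun a d x => ?_⟩
    obtain ⟨b, m, v, rfl⟩ := pair_surj (M := V) (N := U) x
    refine NatTrans.ext (funext fun a' => ?_)
    ext (k : a'.unop ⟶ a)
    exact γ_app m k v

/-! ### Absolute tensors are tensors by represented lex profunctors -/

/-- Absoluteness of tensors by `V` forces each presheaf `V(-, b)` to be a retract of a
representable. The functor `Hom(V(-, b), -)` has to preserve the tensor of the Yoneda embedding by
`V`, whereas the coend of `V(a, -) × Hom(V(-, b), A(-, a))` over `a` is a tensor of its image.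
Hence the identity of `V(-, b)` is in the image of the coend. -/
theorem exists_section_of_tensorsAreAbsolute
    (hV : TensorsAreAbsolute.{max w (u + 1)} (W := LexProf.{u}) (x := A) (y := B) V) (b : B) :
    ∃ (a : A) (v : V.el a b) (n : V.functor.flip.obj b ⟶ yoneda.obj a),
      n ≫ yonedaMap v = 𝟙 _ := by
  let Φ : ((A : Type u)ᵒᵖ ⥤ Type u) ⥤ Type u := coyoneda.obj (op (V.functor.flip.obj b))
  have ht : (lexFunctors.{w} (Type u)).IsTensor (x := A) (y := B) _ V _ _ :=
    hV _ _ (lexFunctorsMap.{w} Φ) _ _ _ V.isTensor_yonedaTensor.{w}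
  let N : LexProfunctor B A :=
    homProf (V.presheaves.{w}).functor (yonedaLex.{w} A).functor
  let T : LexFunctor.{w} B (Type u) := (compProf N V).row b
  -- The comparison from the coend to `Hom(V(-, b), V(-, b'))`.
  let π : compProf N V ⟶ homProf (V.presheaves.{w}).functor (V.presheaves.{w}).functor :=
    whiskerL N V.yonedaTensor.{w} ≫ (lexFunctors.{w} _).comp (x := B) (y := A) (z := B)
      V.presheaves (yonedaLex A) V.presheaves
  -- The coprojections `Hom(V(-, b), A(-, a)) ⟶ T b''` of the coend, for `v` in `V(a, b'')`, extend
  -- along the tensor to a natural family of maps `f` from `Hom(V(-, b), V(-, b''))` to the coend.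
  let g : compProf V (idProf B) ⟶ homProf ((yonedaLex.{w} A).functor ⋙ Φ) (LexFunctor.functor T) :=
    descHom (M := V) (N := idProf B) _
      (fun a b' b'' φ v => homProfEl (↾fun n : V.functor.flip.obj b ⟶ yoneda.obj a =>
        (pair (M := N) (N := V) (V.r (idHom φ) v) n : (compProf N V).el b b'')))
      (fun {a b' b'' c} ψ φ v => by
        rw [idHom_l, r_comp])
      (fun {a a' b' c} ψ φ v => by
        refine ConcreteCategory.hom_ext (C := Type u) _ _ fun n => ?_
        rw [← l_r]
        exact pair_l (M := N) (N := V) ψ _ _)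
      (fun {a b' c c'} ψ φ v => by
        refine ConcreteCategory.hom_ext (C := Type u) _ _ fun n => ?_
        rw [idHom_r, r_comp]
        exact (compProf_r (M := N) (N := V) ψ _ _).symm)
  obtain ⟨f, hf⟩ := (ht (𝟙 B) T).2 g
  -- The composite of `f` with the comparison is the identity, since it is so on the tensor.
  let Y : (lexFunctors.{w} (Type u)).Obj B := (lexFunctorsMap.{w} Φ).obj V.presheaves.{w}
  let πb {b' : B} : (LexFunctor.functor T).obj b' ⟶ (LexFunctor.functor Y).obj b' :=
    (NatTrans.app (F := (compProf N V).functor) π (op b)).app b'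
  have πb_natural {b' b'' : B} (ψ : b' ⟶ b'') :
      (LexFunctor.functor T).map ψ ≫ πb = πb ≫ (LexFunctor.functor Y).map ψ :=
    (NatTrans.app (F := (compProf N V).functor) π (op b)).naturality ψ
  let p : (lexFunctors.{w} (Type u)).hom Y T ⟶ (lexFunctors.{w} (Type u)).hom Y Y :=
    homMk (homProf (LexFunctor.functor Y) (LexFunctor.functor T))
      (homProf (LexFunctor.functor Y) (LexFunctor.functor Y))
      (fun b' b'' k => homProfEl (homProfHom k ≫ πb))
      (fun _ _ _ => Category.assoc _ _ _)
      (fun ψ k => (Category.assoc _ _ _).trans ((congrArg (homProfHom k ≫ ·)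
        (πb_natural ψ)).trans (Category.assoc _ _ _).symm))
  have he : f ≫ p = (lexFunctors.{w} (Type u)).id Y := by
    refine (ht (𝟙 B) Y).1 (LexProfunctor.hom_ext (A := A) (B := B) fun a b'' x => ?_)
    obtain ⟨b', φ, v, rfl⟩ := pair_surj (M := V) (N := idProf B) x
    refine ConcreteCategory.hom_ext (C := Type u) _ _
      fun n : V.functor.flip.obj b ⟶ yoneda.obj a => ?_
    have hn := congrArg (fun s : compProf V (idProf B) ⟶
      homProf ((yonedaLex.{w} A).functor ⋙ Φ) (LexFunctor.functor T) =>
        πb (homProfHom (ev s (pair (M := V) (N := idProf B) φ v)) n)) hf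
    refine hn.trans ?_
    change n ≫ yonedaMap (V.r (idHom φ) v) = (n ≫ yonedaMap v) ≫ V.functor.flip.map (idHom φ)
    rw [Category.assoc]
    refine congrArg (n ≫ ·) (NatTrans.ext (funext fun a' => ?_))
    ext (k : a'.unop ⟶ a)
    exact V.l_r k (idHom φ) v
  have hid := congrArg (fun s : idProf B ⟶ homProf (LexFunctor.functor Y) (LexFunctor.functor Y) =>
    homProfHom (ev s (idEl (𝟙 b))) (𝟙 (V.functor.flip.obj b))) he
  obtain ⟨a, v, n, hx⟩ := pair_surj (M := N) (N := V)
    (homProfHom (G := LexFunctor.functor Y) (H := LexFunctor.functor T)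
      (ev (A := B) (B := B) f (idEl (𝟙 b))) (𝟙 (V.functor.flip.obj b)))
  -- The pair `(v, n)` represents the image of the identity of `V(-, b)` under `f`.
  refine ⟨a, v, n, Eq.trans (congrArg πb hx).symm (hid.trans ?_)⟩
  change 𝟙 _ ≫ V.functor.flip.map (𝟙 b) = 𝟙 _
  rw [CategoryTheory.Functor.map_id, Category.comp_id]

/-- A lex profunctor is represented by a functor as soon as each presheaf `V(-, b)` is
representable. -/
lemma nonempty_representation (h : ∀ b : B, ∃ (a : A) (x : V.el a b), ∀ a' : A,
    Function.Bijective fun f : a' ⟶ a => V.l f x) : Nonempty (Representation V) := by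
  choose F x hx using h
  choose F' hF' using fun {b b' : B} (g : b ⟶ b') => (hx b' (F b)).2 (V.r g (x b))
  replace hF' {b b' : B} (g : b ⟶ b') : V.l (F' g) (x b') = V.r g (x b) := hF' g
  exact ⟨{
    F := {
      obj := F
      map := F'
      map_id := fun b => (hx b (F b)).1 ((hF' (𝟙 b)).trans (by simp))
      map_comp := fun {b b' b''} g g' => (hx b'' (F b)).1 ((hF' (g ≫ g')).trans (by
        change V.r (g ≫ g') (x b) = V.l (F' g ≫ F' g') (x b'')
        rw [l_comp, hF' g', l_r, hF' g, r_comp])) }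
    elt := x
    natural := hF'
    bijective := fun a b => hx b a }⟩

/-- A retract of a representable presheaf is representable, by the equalizer of the corresponding
idempotent and the identity. -/
lemma exists_universal_of_section {a : A} {b : B} (v : V.el a b)
    (n : V.functor.flip.obj b ⟶ yoneda.obj a) (h : n ≫ yonedaMap v = 𝟙 _) :
    ∃ (a' : A) (x : V.el a' b), ∀ a'' : A, Function.Bijective fun f : a'' ⟶ a' => V.l f x := by
  let s {c : A} (x : V.el c b) : c ⟶ a := n.app (op c) x
  have hs {c : A} (x : V.el c b) : V.l (s x) v = x :=
    ConcreteCategory.congr_hom (NatTrans.congr_app h (op c)) x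
  have hl {c c' : A} (f : c' ⟶ c) (x : V.el c b) : s (V.l f x) = f ≫ s x :=
    ConcreteCategory.congr_hom (n.naturality f.op) x
  refine ⟨equalizer (s v) (𝟙 a), V.l (equalizer.ι (s v) (𝟙 a)) v, fun c => ⟨?_, fun x => ?_⟩⟩
  · intro f f' hf
    simp only [← l_comp] at hf
    refine equalizer.hom_ext ?_
    have := congrArg s hf
    rw [hl, hl, Category.assoc, Category.assoc, equalizer.condition] at this
    simpa using this
  · refine ⟨equalizer.lift (s x) ?_, ?_⟩
    · rw [← hl, hs, Category.comp_id]
    · simp only [← l_comp, equalizer.lift_ι, hs]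

/-- Tensors by a lex profunctor are absolute only if it is represented by a functor. -/
theorem nonempty_representation_of_tensorsAreAbsolute
    (hV : TensorsAreAbsolute.{max w (u + 1)} (W := LexProf.{u}) (x := A) (y := B) V) :
    Nonempty (Representation V) :=
  V.nonempty_representation fun b => by
    obtain ⟨a, v, n, h⟩ := V.exists_section_of_tensorsAreAbsolute hV b
    exact V.exists_universal_of_section v n h

end LexProfunctor

/-! ### Absolute-tensored categories -/

theorem mainTheorem6 (C : BicatEnrichedCat.{w} LexProf.{u}) :
    C.IsAbsoluteTensored.{max w (u + 1)} ↔
      ∀ {A B : LexProf.{u}} (X : C.Obj B) (F : (A : Type u) ⥤ (B : Type u))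
        [PreservesFiniteLimits F],
        ∃ Y : C.Obj A, Nonempty (F ⋙ ElementsCat.incl X ≅ ElementsCat.incl Y) := by
  constructor
  · intro h A B X F _
    let R := LexProfunctor.Representation.ofFunctor F
    obtain ⟨Y, ht⟩ := h _ (ElementsCat.tensorsAreAbsolute_of_representation R) X
    exact ⟨Y, (ElementsCat.exists_isTensor_iff R X Y).1 ht⟩
  · intro h A B V hV X
    obtain ⟨R⟩ := LexProfunctor.nonempty_representation_of_tensorsAreAbsolute.{w} V hV
    have := R.preservesFiniteLimits
    obtain ⟨Y, hY⟩ := h X R.F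
    exact ⟨Y, (ElementsCat.exists_isTensor_iff R X Y).2 hY⟩
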